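/- Let $\mathsf A$ be a countable (finite or infinite), effectively presented set of atomic formulae containing two distinct distinguished elements $\top$ and $\bot$, and let $\mathcal L$ be the bimodal propositional language generated from $\mathsf A$ by $\wedge$, $\neg$, $\Box$ and $\mathsf K$. A topological model is a triple $\langle X,\mathcal T,i\rangle$, where $\mathcal T$ is a topology on the set $X$ and $i$ maps $\mathsf A$ to the subsets of $X$ with $i(\top)=X$ and $i(\bot)=\emptyset$. Satisfaction is defined for $U\in\mathcal T$ and $x\in U$ by: $x,U\models A$ iff $x\in i(A)$, for $A\in\mathsf A$; $x,U\models\phi\wedge\psi$ iff $x,U\models\phi$ and $x,U\models\psi$; $x,U\models\neg\phi$ iff not $x,U\models\phi$; $x,U\models\mathsf K\phi$ iff $y,U\models\phi$ for all $y\in U$; $x,U\models\Box\phi$ iff $x,V\models\phi$ for all $V\in\mathcal T$ with $x\in V\subseteq U$. A formula is valid in the model if $x,U\models\phi$ for all $U\in\mathcal T$ and all $x\in U$. Then the theory of topological spaces is decidable: there is an algorithm that decides, for each $\phi\in\mathcal L$, whether $\phi$ is valid in all topological models. -/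

import Mathlib

/-- Formulas of the bimodal propositional language over a set `A` of atomic formulas. -/
inductive BimodalFormula (A : Type*) : Type _
  | atom : A → BimodalFormula A
  | neg : BimodalFormula A → BimodalFormula A
  | and : BimodalFormula A → BimodalFormula A → BimodalFormula A
  | box : BimodalFormula A → BimodalFormula A
  | know : BimodalFormula A → BimodalFormula A

namespace BimodalFormula

/-- The code number of a formula: five constructors, told apart by the residue modulo `5`. -/
def toCode {A : Type*} [Encodable A] : BimodalFormula A → ℕ
  | atom a => 5 * Encodable.encode a
  | neg φ => 5 * toCode φ + 1
  | box φ => 5 * toCode φ + 2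
  | know φ => 5 * toCode φ + 3
  | and φ ψ => 5 * Nat.pair (toCode φ) (toCode ψ) + 4

/-- The formula with a given code number, if there is one. -/
def ofCode {A : Type*} [Encodable A] (n : ℕ) : Option (BimodalFormula A) :=
  if n % 5 = 0 then (Encodable.decode (n / 5) : Option A).map atom
  else if _h1 : n % 5 = 1 then (ofCode (n / 5)).map neg
  else if _h2 : n % 5 = 2 then (ofCode (n / 5)).map box
  else if _h3 : n % 5 = 3 then (ofCode (n / 5)).map know
  else
    (ofCode (n / 5).unpair.1).bind fun φ => (ofCode (n / 5).unpair.2).map fun ψ => and φ ψ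
termination_by n
decreasing_by
  · omega
  · omega
  · omega
  · have := Nat.unpair_left_le (n / 5); omega
  · have := Nat.unpair_right_le (n / 5); omega

theorem ofCode_toCode {A : Type*} [Encodable A] (φ : BimodalFormula A) :
    ofCode φ.toCode = some φ := by
  induction φ with
  | atom a => rw [toCode, ofCode]; simp
  | neg φ ih =>
    rw [toCode, ofCode]
    have h : (5 * φ.toCode + 1) / 5 = φ.toCode := by omega
    have h' : (5 * φ.toCode + 1) % 5 = 1 := by omega
    simp [h, h', ih]
  | box φ ih =>
    rw [toCode, ofCode]
    have h : (5 * φ.toCode + 2) / 5 = φ.toCode := by omega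
    have h' : (5 * φ.toCode + 2) % 5 = 2 := by omega
    simp [h, h', ih]
  | know φ ih =>
    rw [toCode, ofCode]
    have h : (5 * φ.toCode + 3) / 5 = φ.toCode := by omega
    have h' : (5 * φ.toCode + 3) % 5 = 3 := by omega
    simp [h, h', ih]
  | and φ ψ ih₁ ih₂ =>
    rw [toCode, ofCode]
    have h : (5 * Nat.pair φ.toCode ψ.toCode + 4) / 5 = Nat.pair φ.toCode ψ.toCode := by omega
    have h' : (5 * Nat.pair φ.toCode ψ.toCode + 4) % 5 = 4 := by omega
    simp [h, h', ih₁, ih₂]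

instance instEncodable {A : Type*} [Encodable A] : Encodable (BimodalFormula A) where
  encode := toCode
  decode := ofCode
  encodek := ofCode_toCode

theorem primrec_recode {A : Type*} [Primcodable A] :
    Primrec fun n : ℕ => Encodable.encode (Encodable.decode n : Option (BimodalFormula A)) := by
  let step : ℕ → List ℕ → ℕ := fun n l =>
    if n % 5 = 0 then
      (if Encodable.encode (Encodable.decode (n / 5) : Option A) = 0 then 0
        else 5 * (Encodable.encode (Encodable.decode (n / 5) : Option A) - 1) + 1)
    else if n % 5 = 4 then
      (if l[(n / 5).unpair.1]?.getD 0 = 0 then 0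
        else if l[(n / 5).unpair.2]?.getD 0 = 0 then 0
        else 5 * Nat.pair (l[(n / 5).unpair.1]?.getD 0 - 1) (l[(n / 5).unpair.2]?.getD 0 - 1) + 5)
    else
      (if l[n / 5]?.getD 0 = 0 then 0 else 5 * (l[n / 5]?.getD 0 - 1) + n % 5 + 1)
  have hstep : Primrec₂ fun (_ : Unit) (l : List ℕ) => some (step l.length l) := by
    have hn : Primrec fun p : Unit × List ℕ => p.2.length := Primrec.list_length.comp Primrec.snd
    have hm : Primrec fun p : Unit × List ℕ => p.2.length / 5 :=
      Primrec.nat_div.comp hn (Primrec.const 5)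
    have hk : Primrec fun p : Unit × List ℕ => p.2.length % 5 :=
      Primrec.nat_mod.comp hn (Primrec.const 5)
    have hu : Primrec fun p : Unit × List ℕ => (p.2.length / 5).unpair := Primrec.unpair.comp hm
    have look : ∀ {f : Unit × List ℕ → ℕ}, Primrec f →
        Primrec fun p : Unit × List ℕ => p.2[f p]?.getD 0 := fun hf =>
      Primrec.option_getD.comp (Primrec.list_getElem?.comp Primrec.snd hf) (Primrec.const 0)
    have he : Primrec fun p : Unit × List ℕ =>
        Encodable.encode (Encodable.decode (p.2.length / 5) : Option A) := Primrec.encdec.comp hm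
    have isc : ∀ {f : Unit × List ℕ → ℕ} (c : ℕ), Primrec f → PrimrecPred fun p => f p = c :=
      fun c hf => Primrec.eq.comp hf (Primrec.const c)
    have pre : ∀ {f : Unit × List ℕ → ℕ}, Primrec f → Primrec fun p => f p - 1 :=
      fun hf => Primrec.nat_sub.comp hf (Primrec.const 1)
    have mul5 : ∀ {f : Unit × List ℕ → ℕ}, Primrec f → Primrec fun p => 5 * f p :=
      fun hf => Primrec.nat_mul.comp (Primrec.const 5) hf
    have addc : ∀ {f : Unit × List ℕ → ℕ} (c : ℕ), Primrec f → Primrec fun p => f p + c :=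
      fun c hf => Primrec.nat_add.comp hf (Primrec.const c)
    refine Primrec.option_some.comp (Primrec.ite (isc 0 hk) ?_ (Primrec.ite (isc 4 hk) ?_ ?_))
    · exact Primrec.ite (isc 0 he) (Primrec.const 0) (addc 1 (mul5 (pre he)))
    · have h1 := look (Primrec.fst.comp hu)
      have h2 := look (Primrec.snd.comp hu)
      exact Primrec.ite (isc 0 h1) (Primrec.const 0) (Primrec.ite (isc 0 h2) (Primrec.const 0)
        (addc 5 (mul5 (Primrec₂.natPair.comp (pre h1) (pre h2)))))
    · exact Primrec.ite (isc 0 (look hm)) (Primrec.const 0)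
        (addc 1 (Primrec.nat_add.comp (mul5 (pre (look hm))) hk))
  have key := Primrec.nat_strong_rec
    (fun (_ : Unit) (n : ℕ) => Encodable.encode (Encodable.decode n : Option (BimodalFormula A)))
    hstep ?_
  · exact key.comp (Primrec.const ()) Primrec.id
  · intro _ n
    simp only [List.length_map, List.length_range, Option.some.injEq]
    have hl : ∀ i < n, ((List.range n).map fun k => Encodable.encode
        (Encodable.decode k : Option (BimodalFormula A)))[i]?.getD 0 =
        Encodable.encode (ofCode i : Option (BimodalFormula A)) := by
      intro i hi
      simp [hi]
      rfl
    change _ = Encodable.encode (ofCode n : Option (BimodalFormula A))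
    rw [ofCode]
    simp only [step]
    have h5 : n % 5 < 5 := Nat.mod_lt _ (by norm_num)
    have hu1 := Nat.unpair_left_le (n / 5)
    have hu2 := Nat.unpair_right_le (n / 5)
    by_cases h0 : n % 5 = 0
    · rw [if_pos h0, if_pos h0]
      cases (Encodable.decode (n / 5) : Option A) with
      | none => simp
      | some a => simp [Encodable.encode, toCode]
    rw [if_neg h0, if_neg h0]
    by_cases h4 : n % 5 = 4
    · rw [if_pos h4, hl _ (by omega), hl _ (by omega)]
      cases (ofCode (n / 5).unpair.1 : Option (BimodalFormula A)) with
      | none => simp [h4]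
      | some φ =>
        cases (ofCode (n / 5).unpair.2 : Option (BimodalFormula A)) with
        | none => simp [h4]
        | some ψ => simp [h4, Encodable.encode, toCode]
    · rw [if_neg h4, hl _ (by omega)]
      have h : n % 5 = 1 ∨ n % 5 = 2 ∨ n % 5 = 3 := by omega
      cases (ofCode (n / 5) : Option (BimodalFormula A)) with
      | none => rcases h with h | h | h <;> simp [h]
      | some φ => rcases h with h | h | h <;> simp [h, Encodable.encode, toCode]

/-- Formulas are finite objects, on which computability is meaningful. -/
instance instPrimcodable {A : Type*} [Primcodable A] : Primcodable (BimodalFormula A) where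
  prim := Primrec.nat_iff.1 primrec_recode

end BimodalFormula

/-- A subset space: a family of subsets of `X` that contains `X` itself. -/
structure SubsetSpace (X : Type*) where
  opens : Set (Set X)
  univ_mem : Set.univ ∈ opens

/-- A model over `X`, for a set `A` of atomic formulas with distinguished elements `t` (truth)
and `f` (falsity). -/
structure SubsetModel {A : Type*} (t f : A) (X : Type*) extends SubsetSpace X where
  interp : A → Set X
  interp_true : interp t = Set.univ
  interp_false : interp f = ∅

namespace SubsetModel

/-- Satisfaction `x, U ⊨ φ`; it is meaningful for `U ∈ M.opens` and `x ∈ U`, and all recursive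
calls from such a pair are at such pairs. -/
def Sat {A : Type*} {t f : A} {X : Type*} (M : SubsetModel t f X) :
    X → Set X → BimodalFormula A → Prop
  | x, _, .atom a => x ∈ M.interp a
  | x, U, .neg φ => ¬ M.Sat x U φ
  | x, U, .and φ ψ => M.Sat x U φ ∧ M.Sat x U ψ
  | x, U, .box φ => ∀ V ∈ M.opens, V ⊆ U → x ∈ V → M.Sat x V φ
  | _, U, .know φ => ∀ y ∈ U, M.Sat y U φ

/-- A formula is valid in `M` if it is satisfied at all pairs `(x, U)` with `x ∈ U ∈ M.opens`. -/
def Valid {A : Type*} {t f : A} {X : Type*} (M : SubsetModel t f X)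
    (φ : BimodalFormula A) : Prop :=
  ∀ x : X, ∀ U ∈ M.opens, x ∈ U → M.Sat x U φ

/-- `M` is a topological model if its subsets are the open sets of a topology on `X`. -/
def IsTopological {A : Type*} {t f : A} {X : Type*} (M : SubsetModel t f X) : Prop :=
  ∃ τ : TopologicalSpace X, M.opens = {U | @IsOpen X τ U}

end SubsetModel

universe u v

/-- The theory of topological spaces: the formulas valid in all topological models. -/
def topologicalTheory {A : Type v} (t f : A) : Set (BimodalFormula A) :=
  {φ | ∀ (X : Type u) (M : SubsetModel t f X), M.IsTopological → M.Valid φ}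

/-! The theory has a finite model property with a computable bound, so invalidity reduces to a
bounded search.

Fix a topological model. A finite family `F` of open sets splits a formula if its truth at a pair
`(x, V)`, with `x` fixed, depends only on which members of `F` contain `V`. A family splitting the
smaller formulas is enlarged to split the next one. For knowledge, add for each possible set `s` of
supersets the union of those open sets with supersets `s` on which the subformula is known. For the
box, add Heyting implications, which record how the trace of an open set changes when it is cut down
by an intersection of members of `F`. These steps are `splits_know` and `splits_box`; the number of
sets added is bounded independently of the space.

Identify points lying in the same members of `F` and satisfying the same relevant atoms. The
quotient is finite. Truth survives because an open set may be replaced by its hull, the intersection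
of the members of `F` above it, which is open and a union of classes (`codeSat_quotient_iff`). A
finite topology consists of the sets closed under a relation, so the relation, the valuation and a
truth table fit into three natural numbers below computable bounds. Checking them uses only bounded
quantifiers over bits and is primitive recursive; conversely, every such certificate describes a
topological model. -/

/-! ### Satisfaction on code numbers -/

/-- Satisfaction read off from code numbers of formulas over atoms numbered by `ℕ`, with
respect to a family `O` of sets. -/
def CodeSat {X : Type*} (O : Set (Set X)) (v : ℕ → Set X) (e : ℕ) (x : X) (U : Set X) : Prop :=
  if _h0 : e % 5 = 0 then x ∈ v (e / 5)
  else if _h1 : e % 5 = 1 then ¬ CodeSat O v (e / 5) x U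
  else if _h2 : e % 5 = 2 then ∀ V ∈ O, V ⊆ U → x ∈ V → CodeSat O v (e / 5) x V
  else if _h3 : e % 5 = 3 then ∀ y ∈ U, CodeSat O v (e / 5) y U
  else CodeSat O v (e / 5).unpair.1 x U ∧ CodeSat O v (e / 5).unpair.2 x U
termination_by e
decreasing_by
  · omega
  · omega
  · omega
  · have := Nat.unpair_left_le (e / 5); omega
  · have := Nat.unpair_right_le (e / 5); omega

section CodeSat

variable {X : Type*} {O : Set (Set X)} {v : ℕ → Set X} {e : ℕ} {x : X} {U : Set X}

theorem codeSat_atom (h : e % 5 = 0) : CodeSat O v e x U ↔ x ∈ v (e / 5) := by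
  rw [CodeSat, dif_pos h]

theorem codeSat_neg (h : e % 5 = 1) : CodeSat O v e x U ↔ ¬ CodeSat O v (e / 5) x U := by
  rw [CodeSat, dif_neg (by omega), dif_pos h]

theorem codeSat_box (h : e % 5 = 2) :
    CodeSat O v e x U ↔ ∀ V ∈ O, V ⊆ U → x ∈ V → CodeSat O v (e / 5) x V := by
  rw [CodeSat, dif_neg (by omega), dif_neg (by omega), dif_pos h]

theorem codeSat_know (h : e % 5 = 3) :
    CodeSat O v e x U ↔ ∀ y ∈ U, CodeSat O v (e / 5) y U := by
  rw [CodeSat, dif_neg (by omega), dif_neg (by omega), dif_neg (by omega), dif_pos h]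

theorem codeSat_and (h : e % 5 = 4) :
    CodeSat O v e x U ↔
      CodeSat O v (e / 5).unpair.1 x U ∧ CodeSat O v (e / 5).unpair.2 x U := by
  rw [CodeSat, dif_neg (by omega), dif_neg (by omega), dif_neg (by omega), dif_neg (by omega)]

/-- Strong induction along the immediate subformulas of a code number. -/
theorem code_induction {P : ℕ → Prop} (atom : ∀ e, e % 5 = 0 → P e)
    (neg : ∀ e, e % 5 = 1 → e / 5 < e → P (e / 5) → P e)
    (box : ∀ e, e % 5 = 2 → e / 5 < e → P (e / 5) → P e)
    (know : ∀ e, e % 5 = 3 → e / 5 < e → P (e / 5) → P e)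
    (and : ∀ e, e % 5 = 4 → (e / 5).unpair.1 < e → (e / 5).unpair.2 < e →
      P (e / 5).unpair.1 → P (e / 5).unpair.2 → P e) (e : ℕ) : P e := by
  induction e using Nat.strong_induction_on with
  | _ e ih =>
    have h : e % 5 = 0 ∨ e % 5 = 1 ∨ e % 5 = 2 ∨ e % 5 = 3 ∨ e % 5 = 4 := by omega
    have h1 := Nat.unpair_left_le (e / 5)
    have h2 := Nat.unpair_right_le (e / 5)
    rcases h with h | h | h | h | h
    · exact atom e h
    · exact neg e h (by omega) (ih _ (by omega))
    · exact box e h (by omega) (ih _ (by omega))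
    · exact know e h (by omega) (ih _ (by omega))
    · exact and e h (by omega) (by omega) (ih _ (by omega)) (ih _ (by omega))

end CodeSat

theorem SubsetModel.sat_iff_codeSat {A : Type*} [Encodable A] {t f : A} {X : Type*}
    (M : SubsetModel t f X) {v : ℕ → Set X} (hv : ∀ a, v (Encodable.encode a) = M.interp a)
    (φ : BimodalFormula A) (x : X) (U : Set X) :
    M.Sat x U φ ↔ CodeSat M.opens v φ.toCode x U := by
  induction φ generalizing x U with
  | atom a =>
    rw [BimodalFormula.toCode, codeSat_atom (by omega), Nat.mul_div_cancel_left _ (by omega), hv]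
    rfl
  | neg φ ih =>
    have h : (5 * φ.toCode + 1) / 5 = φ.toCode := by omega
    rw [BimodalFormula.toCode, codeSat_neg (by omega), h, ← ih]
    rfl
  | box φ ih =>
    have h : (5 * φ.toCode + 2) / 5 = φ.toCode := by omega
    rw [BimodalFormula.toCode, codeSat_box (by omega), h]
    simp only [← ih]
    rfl
  | know φ ih =>
    have h : (5 * φ.toCode + 3) / 5 = φ.toCode := by omega
    rw [BimodalFormula.toCode, codeSat_know (by omega), h]
    simp only [← ih]
    rfl
  | and φ ψ ih₁ ih₂ =>
    have h : (5 * Nat.pair φ.toCode ψ.toCode + 4) / 5 = Nat.pair φ.toCode ψ.toCode := by omega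
    rw [BimodalFormula.toCode, codeSat_and (by omega), h, Nat.unpair_pair, ← ih₁, ← ih₂]
    rfl

/-- Membership in the theory, in terms of code numbers. -/
theorem mem_topologicalTheory_iff {A : Type v} [Encodable A] {t f : A} (φ : BimodalFormula A) :
    φ ∈ topologicalTheory.{u, v} t f ↔
      ∀ (X : Type u) [TopologicalSpace X] (v : ℕ → Set X), v (Encodable.encode t) = Set.univ →
        v (Encodable.encode f) = ∅ → ∀ (x : X) (U : Set X), IsOpen U → x ∈ U →
          CodeSat {V | IsOpen V} v φ.toCode x U := by
  constructor
  · intro h X _ v ht hf x U hU hx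
    let M : SubsetModel t f X :=
      { opens := {V | IsOpen V}
        univ_mem := isOpen_univ
        interp := fun a => v (Encodable.encode a)
        interp_true := ht
        interp_false := hf }
    exact (M.sat_iff_codeSat (fun _ => rfl) φ x U).1 (h X M ⟨_, rfl⟩ x U hU hx)
  · intro h X M ⟨τ, hτ⟩ x U hU hx
    -- Numbers that encode no atom receive the empty set; they do not occur in the code of a
    -- formula.
    let v : ℕ → Set X := fun k => {x | ∃ a, Encodable.encode a = k ∧ x ∈ M.interp a}
    have hv : ∀ a, v (Encodable.encode a) = M.interp a := fun a => by
      ext y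
      simp [v]
    rw [M.sat_iff_codeSat hv, hτ]
    exact h X v ((hv t).trans M.interp_true) ((hv f).trans M.interp_false) x U
      (by rw [hτ] at hU; exact hU) hx

/-! ### Splitting families of open sets -/

/-- Two sets agree on `F` if they are contained in the same members of `F`. -/
def AgreeOn {X : Type*} (F : Finset (Set X)) (V W : Set X) : Prop :=
  ∀ U ∈ F, V ⊆ U ↔ W ⊆ U

/-- The truth of `e` at open neighbourhoods of a point depends only on the members of `F` that
contain the neighbourhood. -/
def Splits {X : Type*} [TopologicalSpace X] (v : ℕ → Set X) (F : Finset (Set X)) (e : ℕ) : Prop :=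
  ∀ V W, IsOpen V → IsOpen W → AgreeOn F V W → ∀ x, x ∈ V → x ∈ W →
    (CodeSat {V | IsOpen V} v e x V ↔ CodeSat {V | IsOpen V} v e x W)

section Hull

variable {X : Type*} {F G : Finset (Set X)}

theorem AgreeOn.mono (h : F ⊆ G) {V W : Set X} (hG : AgreeOn G V W) : AgreeOn F V W :=
  fun U hU => hG U (h hU)

/-- The largest set with the same supersets in `F` as `V`. -/
def hull (F : Finset (Set X)) (V : Set X) : Set X :=
  ⋂₀ {U | U ∈ F ∧ V ⊆ U}

theorem subset_hull (V : Set X) : V ⊆ hull F V :=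
  fun _ hx _ hU => hU.2 hx

/-- This is what allows an open set to be enlarged towards its hull without changing the truth of
formulas split by `F`. -/
theorem agreeOn_of_subset_hull {V W : Set X} (h1 : V ⊆ W) (h2 : W ⊆ hull F V) :
    AgreeOn F V W :=
  fun U hU => ⟨fun h => h2.trans fun _ hx => hx U ⟨hU, h⟩, fun h => h1.trans h⟩

end Hull

section Splitting

variable {X : Type*} [TopologicalSpace X] {v : ℕ → Set X} {F G : Finset (Set X)} {e : ℕ}

theorem Splits.mono (h : F ⊆ G) (hF : Splits v F e) : Splits v G e :=
  fun V W hV hW hVW => hF V W hV hW (hVW.mono h)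

theorem isOpen_hull (hF : ∀ U ∈ F, IsOpen U) (V : Set X) : IsOpen (hull F V) :=
  Set.Finite.isOpen_sInter (F.finite_toSet.subset fun _ h => h.1) fun U hU => hF U hU.1

open Classical in
/-- The union of the open sets `V` with prescribed supersets in `F` that satisfy `e`
throughout. -/
def knowSet (v : ℕ → Set X) (F : Finset (Set X)) (e : ℕ) (s : Finset (Set X)) : Set X :=
  ⋃₀ {V | IsOpen V ∧ F.filter (V ⊆ ·) = s ∧ ∀ x ∈ V, CodeSat {V | IsOpen V} v e x V}

/-- The Heyting implication from the intersection of `p.1` to `p.2`. -/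
def boxSet (p : Finset (Set X) × Set X) : Set X :=
  interior ((⋂₀ (p.1 : Set (Set X)))ᶜ ∪ p.2)

/-- Adjunction between meet and implication. Hence the trace on `F` of `V` cut down by members of
`F` can be read off from the sets `boxSet` that contain `V`. -/
theorem subset_boxSet_iff {s : Finset (Set X)} {U V : Set X} (hV : IsOpen V) :
    V ⊆ boxSet (s, U) ↔ V ∩ ⋂₀ (s : Set (Set X)) ⊆ U := by
  rw [boxSet, hV.subset_interior_iff]
  constructor
  · rintro h x ⟨hx, hs⟩
    exact (h hx).resolve_left fun hn => hn hs
  · intro h x hx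
    by_cases hs : x ∈ ⋂₀ (s : Set (Set X))
    · exact Or.inr (h ⟨hx, hs⟩)
    · exact Or.inl hs

open Classical in
/-- The enlargement of `F` that handles both modalities applied to `e`. -/
noncomputable def refinement (v : ℕ → Set X) (F : Finset (Set X)) (e : ℕ) : Finset (Set X) :=
  F ∪ (F.powerset.image (knowSet v F e) ∪ (F.powerset ×ˢ F).image boxSet)

theorem subset_refinement : F ⊆ refinement v F e :=
  Finset.subset_union_left

/-- The summands count the old sets, one `knowSet` per subset of `F`, and one `boxSet` per pair of a
subset and a member of `F`. -/
theorem card_refinement_le {b : ℕ} (h : F.card ≤ b) :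
    (refinement v F e).card ≤ b + (2 ^ b + 2 ^ b * b) := by
  classical
  have hp : F.powerset.card ≤ 2 ^ b := by
    rw [Finset.card_powerset]
    exact Nat.pow_le_pow_right (by omega) h
  refine (Finset.card_union_le _ _).trans (Nat.add_le_add h ?_)
  refine (Finset.card_union_le _ _).trans (Nat.add_le_add ?_ ?_)
  · exact Finset.card_image_le.trans hp
  · refine Finset.card_image_le.trans ?_
    rw [Finset.card_product]
    exact Nat.mul_le_mul hp h

theorem isOpen_of_mem_refinement (hF : ∀ U ∈ F, IsOpen U) : ∀ U ∈ refinement v F e, IsOpen U := by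
  classical
  intro U hU
  rw [refinement, Finset.mem_union, Finset.mem_union, Finset.mem_image, Finset.mem_image] at hU
  rcases hU with hU | ⟨s, -, rfl⟩ | ⟨p, -, rfl⟩
  · exact hF U hU
  · exact isOpen_sUnion fun V hV => hV.1
  · exact isOpen_interior

theorem knowSet_mem_refinement {s : Finset (Set X)} (hs : s ⊆ F) :
    knowSet v F e s ∈ refinement v F e := by
  classical
  exact Finset.mem_union_right _ (Finset.mem_union_left _
    (Finset.mem_image_of_mem _ (Finset.mem_powerset.2 hs)))

theorem boxSet_mem_refinement {s : Finset (Set X)} (hs : s ⊆ F) {U : Set X} (hU : U ∈ F) :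
    boxSet (s, U) ∈ refinement v F e := by
  classical
  exact Finset.mem_union_right _ (Finset.mem_union_right _
    (Finset.mem_image_of_mem _ (Finset.mem_product.2 ⟨Finset.mem_powerset.2 hs, hU⟩)))

/-- An open `V` with trace `s` knows the subformula exactly when `V ⊆ knowSet v F (k / 5) s`: each
point of `V` then lies in some open `V'` with trace `s` that knows it, and splitting moves its truth
at that point from `V'` to `V`. -/
theorem splits_know {k : ℕ} (hk : k % 5 = 3) (h : Splits v F (k / 5)) :
    Splits v (refinement v F (k / 5)) k := by
  classical
  have key : ∀ V W, IsOpen V → IsOpen W → AgreeOn (refinement v F (k / 5)) V W →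
      (∀ y ∈ V, CodeSat {V | IsOpen V} v (k / 5) y V) →
      ∀ y ∈ W, CodeSat {V | IsOpen V} v (k / 5) y W := by
    intro V W hV hW hVW hsat y hy
    have hsub : V ⊆ knowSet v F (k / 5) (F.filter (V ⊆ ·)) :=
      Set.subset_sUnion_of_mem ⟨hV, rfl, hsat⟩
    have hsub' := (hVW _ (knowSet_mem_refinement (Finset.filter_subset _ _))).1 hsub
    obtain ⟨V', ⟨hV', heq, hsat'⟩, hy'⟩ := hsub' hy
    refine (h V' W hV' hW (fun U hU => ?_) y hy' hy).1 (hsat' y hy')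
    rw [← hVW U (subset_refinement hU)]
    have := Finset.ext_iff.1 heq U
    simpa [hU] using this
  intro V W hV hW hVW x _ _
  rw [codeSat_know hk, codeSat_know hk]
  exact ⟨key V W hV hW hVW, key W V hW hV fun U hU => (hVW U hU).symm⟩

/-- A neighbourhood `W' ⊆ W` is matched inside `V` by `V ∩ hull F W'`. The added implications give
this set the same trace as `W ∩ hull F W'`, which lies between `W'` and its hull and so has the
trace of `W'`. -/
theorem splits_box (hF : ∀ U ∈ F, IsOpen U) {k : ℕ} (hk : k % 5 = 2) (h : Splits v F (k / 5)) :
    Splits v (refinement v F (k / 5)) k := by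
  classical
  have key : ∀ V W, IsOpen V → IsOpen W → AgreeOn (refinement v F (k / 5)) V W →
      ∀ x, x ∈ V → x ∈ W → CodeSat {V | IsOpen V} v k x V → CodeSat {V | IsOpen V} v k x W := by
    intro V W hV hW hVW x hxV hxW
    rw [codeSat_box hk, codeSat_box hk]
    intro hsat W' hW' hsub hx
    have hhull : hull F W' = ⋂₀ ((F.filter (W' ⊆ ·) : Finset (Set X)) : Set (Set X)) := by
      simp [hull]
    have hxh : x ∈ hull F W' := subset_hull W' hx
    refine (h (V ∩ hull F W') W' (hV.inter (isOpen_hull hF W')) hW' (fun U hU => ?_) x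
      ⟨hxV, hxh⟩ hx).1
      (hsat _ (hV.inter (isOpen_hull hF W')) Set.inter_subset_left ⟨hxV, hxh⟩)
    have h1 : V ∩ hull F W' ⊆ U ↔ W ∩ hull F W' ⊆ U := by
      rw [hhull, ← subset_boxSet_iff hV, ← subset_boxSet_iff hW]
      exact hVW _ (boxSet_mem_refinement (Finset.filter_subset _ _) hU)
    rw [h1]
    exact (agreeOn_of_subset_hull (Set.subset_inter hsub (subset_hull W'))
      Set.inter_subset_right U hU).symm
  intro V W hV hW hVW x hxV hxW
  exact ⟨key V W hV hW hVW x hxV hxW, key W V hW hV (fun U hU => (hVW U hU).symm) x hxW hxV⟩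

/-- Only the modalities need new sets: atoms ignore the neighbourhood, and the Boolean connectives
inherit splitting from their parts, whose codes are smaller. -/
theorem splits_refinement (hF : ∀ U ∈ F, IsOpen U) {k : ℕ} (h : ∀ e < k, Splits v F e) :
    Splits v (refinement v F (k / 5)) k := by
  have hs : ∀ e < k, Splits v (refinement v F (k / 5)) e := fun e he => (h e he).mono subset_refinement
  have h1 := Nat.unpair_left_le (k / 5)
  have h2 := Nat.unpair_right_le (k / 5)
  have hk : k % 5 = 0 ∨ k % 5 = 1 ∨ k % 5 = 2 ∨ k % 5 = 3 ∨ k % 5 = 4 := by omega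
  rcases hk with hk | hk | hk | hk | hk
  · intro V W _ _ _ x _ _
    rw [codeSat_atom hk, codeSat_atom hk]
  · intro V W hV hW hVW x hxV hxW
    rw [codeSat_neg hk, codeSat_neg hk, hs _ (by omega) V W hV hW hVW x hxV hxW]
  · exact splits_box hF hk (h _ (by omega))
  · exact splits_know hk (h _ (by omega))
  · intro V W hV hW hVW x hxV hxW
    rw [codeSat_and hk, codeSat_and hk, hs _ (by omega) V W hV hW hVW x hxV hxW,
      hs (k / 5).unpair.2 (by omega) V W hV hW hVW x hxV hxW]

/-- A bound for the number of open sets that split all formulas with code below `d`. -/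
def splitBound (d : ℕ) : ℕ :=
  Nat.rec 0 (fun _ b => b + (2 ^ b + 2 ^ b * b)) d

/-- All codes below `d` are treated in turn, which covers every subformula and makes the bound a
function of `d` alone. -/
theorem exists_splits (v : ℕ → Set X) (d : ℕ) :
    ∃ F : Finset (Set X), (∀ U ∈ F, IsOpen U) ∧ F.card ≤ splitBound d ∧
      ∀ e < d, Splits v F e := by
  induction d with
  | zero => exact ⟨∅, by simp, by simp, by simp⟩
  | succ d ih =>
    obtain ⟨F, hF, hcard, hs⟩ := ih
    refine ⟨refinement v F (d / 5), isOpen_of_mem_refinement hF, card_refinement_le hcard, fun e he => ?_⟩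
    rcases Nat.lt_succ_iff_lt_or_eq.1 he with he | rfl
    · exact (hs e he).mono subset_refinement
    · exact splits_refinement hF hs

end Splitting

/-! ### Finite quotients and the finite model property -/

/-- Points are classified by their membership in the sets of `F` and in `v a` for `a < d`; the bound
counts the possible patterns. -/
theorem exists_finite_quotient {X : Type*} (F : Finset (Set X)) (v : ℕ → Set X) (d : ℕ) :
    ∃ n ≤ 2 ^ F.card * 2 ^ d, ∃ π : X → Fin n, Function.Surjective π ∧
      (∀ U ∈ F, ∀ x y, π x = π y → x ∈ U → y ∈ U) ∧
      ∀ a < d, ∀ x y, π x = π y → x ∈ v a → y ∈ v a := by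
  let g : X → (F → Prop) × (Fin d → Prop) := fun x => (fun U => x ∈ U.1, fun a => x ∈ v a)
  let ε := Finite.equivFin (Set.range g)
  have hπ : ∀ x y, ε ⟨g x, x, rfl⟩ = ε ⟨g y, y, rfl⟩ → g x = g y := fun x y h =>
    congrArg Subtype.val (ε.injective h)
  refine ⟨Nat.card (Set.range g), ?_, fun x => ε ⟨g x, x, rfl⟩, ?_, ?_, ?_⟩
  · refine (Nat.card_le_card_of_injective _ Subtype.val_injective).trans (le_of_eq ?_)
    classical
    simp [Nat.card_eq_fintype_card]
  · intro i
    obtain ⟨⟨_, x, rfl⟩, rfl⟩ := ε.surjective i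
    exact ⟨x, rfl⟩
  · intro U hU x y h hx
    exact (congrFun (congrArg Prod.fst (hπ x y h)) ⟨U, hU⟩).mp hx
  · intro a ha x y h hx
    exact (congrFun (congrArg Prod.snd (hπ x y h)) ⟨a, ha⟩).mp hx

section FiniteModel

variable {X : Type*} [TopologicalSpace X] {v : ℕ → Set X}

/-- Passing to a quotient that respects a splitting family and the atoms preserves truth. -/
theorem codeSat_quotient_iff {Y : Type*} {π : X → Y} {F : Finset (Set X)} {d : ℕ}
    (hF : ∀ U ∈ F, IsOpen U) (hs : ∀ e < d, Splits v F e)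
    (hmem : ∀ U ∈ F, ∀ x y, π x = π y → x ∈ U → y ∈ U)
    (hatom : ∀ a < d, ∀ x y, π x = π y → x ∈ v a → y ∈ v a) (hπ : Function.Surjective π)
    (e : ℕ) : e < d → ∀ (x : X) (O : Set Y), IsOpen (π ⁻¹' O) → π x ∈ O →
      (CodeSat {O | IsOpen (π ⁻¹' O)} (fun a => π '' v a) e (π x) O ↔
        CodeSat {V | IsOpen V} v e x (π ⁻¹' O)) := by
  induction e using code_induction with
  | atom e he =>
    intro hd x O _ _
    rw [codeSat_atom he, codeSat_atom he]
    constructor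
    · rintro ⟨y, hy, hyx⟩
      exact hatom _ (by omega) y x hyx hy
    · exact fun hx => ⟨x, hx, rfl⟩
  | neg e he hlt ih =>
    intro hd x O hO hx
    rw [codeSat_neg he, codeSat_neg he, ih (by omega) x O hO hx]
  | box e he hlt ih =>
    intro hd x O hO hx
    rw [codeSat_box he, codeSat_box he]
    constructor
    · intro h V hV hVO hxV
      -- The set `V` need not be a union of fibres of `π`. Its substitute `π ⁻¹' O ∩ hull F V` is,
      -- and it is open with the same trace on `F`.
      have hsat : ∀ x y, π x = π y → x ∈ π ⁻¹' O ∩ hull F V → y ∈ π ⁻¹' O ∩ hull F V := by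
        rintro x y hxy ⟨h1, h2⟩
        exact ⟨by rwa [Set.mem_preimage, ← hxy], fun U hU => hmem U hU.1 x y hxy (h2 U hU)⟩
      have hpre : π ⁻¹' (π '' (π ⁻¹' O ∩ hull F V)) = π ⁻¹' O ∩ hull F V := by
        refine Set.Subset.antisymm ?_ (Set.subset_preimage_image _ _)
        rintro y ⟨z, hz, hzy⟩
        exact hsat z y hzy hz
      have hopen : IsOpen (π ⁻¹' O ∩ hull F V) := hO.inter (isOpen_hull hF V)
      have hxm : x ∈ π ⁻¹' O ∩ hull F V := ⟨hx, subset_hull V hxV⟩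
      have hopen' : IsOpen (π ⁻¹' (π '' (π ⁻¹' O ∩ hull F V))) := by rwa [hpre]
      have := h (π '' (π ⁻¹' O ∩ hull F V)) hopen'
        (by rintro _ ⟨y, hy, rfl⟩; exact hy.1) ⟨x, hxm, rfl⟩
      rw [ih (by omega) x _ hopen' ⟨x, hxm, rfl⟩, hpre] at this
      exact (hs _ (by omega) V _ hV hopen (agreeOn_of_subset_hull
        (Set.subset_inter hVO (subset_hull V)) Set.inter_subset_right) x hxV hxm).2 this
    · intro h P hP hPO hxP
      exact (ih (by omega) x P hP hxP).2 (h _ hP (Set.preimage_mono hPO) hxP)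
  | know e he hlt ih =>
    intro hd x O hO hx
    rw [codeSat_know he, codeSat_know he]
    constructor
    · exact fun h y hy => (ih (by omega) y O hO hy).1 (h _ hy)
    · intro h z hz
      obtain ⟨y, rfl⟩ := hπ z
      exact (ih (by omega) y O hO hz).2 (h y hz)
  | and e he h1 h2 ih1 ih2 =>
    intro hd x O hO hx
    rw [codeSat_and he, codeSat_and he, ih1 (by omega) x O hO hx, ih2 (by omega) x O hO hx]

/-- The sets closed under a relation; these are the open sets of a topology. -/
def upClosed {Y : Type*} (R : Y → Y → Prop) : Set (Set Y) :=
  {U | ∀ x ∈ U, ∀ y, R x y → y ∈ U}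

/-- The number of points that suffices to refute the formula with code `d`. -/
def sizeBound (d : ℕ) : ℕ :=
  2 ^ splitBound (d + 1) * 2 ^ (d + 1)

/-- In a finite space every point has a least open neighbourhood, so a set is open as soon as it is
closed under passing from `x` to the points `y` that specialize to `x`. -/
theorem setOf_isOpen_eq_upClosed {Y : Type*} [TopologicalSpace Y] [Finite Y] :
    {O : Set Y | IsOpen O} = upClosed fun x y => y ⤳ x := by
  ext O
  exact isOpen_iff_forall_specializes.trans
    ⟨fun h x hx y hyx => h y x hyx hx, fun h x y hxy hy => h y hy x hxy⟩

theorem exists_finite_countermodel {d : ℕ} {x : X} {U : Set X} (hU : IsOpen U) (hx : x ∈ U)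
    (h : ¬ CodeSat {V | IsOpen V} v d x U) :
    ∃ n ≤ sizeBound d, ∃ (R : Fin n → Fin n → Prop) (π : X → Fin n), Function.Surjective π ∧
      ∃ y, ∃ O ∈ upClosed R, y ∈ O ∧ ¬ CodeSat (upClosed R) (fun a => π '' v a) d y O := by
  obtain ⟨F, hF, hcard, hs⟩ := exists_splits v (d + 1)
  obtain ⟨n, hn, π, hπ, hmem, hatom⟩ := exists_finite_quotient F v (d + 1)
  have hopens : {O : Set (Fin n) | IsOpen (π ⁻¹' O)} =
      upClosed fun x y => @Specializes _ (TopologicalSpace.coinduced π inferInstance) y x := by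
    let _ : TopologicalSpace (Fin n) := TopologicalSpace.coinduced π inferInstance
    rw [← setOf_isOpen_eq_upClosed]
    rfl
  -- The failure at `U` is moved to `hull F U`, which is the preimage of its image.
  have hpre : π ⁻¹' (π '' hull F U) = hull F U := by
    refine Set.Subset.antisymm ?_ (Set.subset_preimage_image _ _)
    rintro y ⟨z, hz, hzy⟩ V hV
    exact hmem V hV.1 z y hzy (hz V hV)
  have hopen : IsOpen (π ⁻¹' (π '' hull F U)) := by
    rw [hpre]
    exact isOpen_hull hF U
  have hxh : x ∈ hull F U := subset_hull U hx
  refine ⟨n, hn.trans (Nat.mul_le_mul (Nat.pow_le_pow_right (by omega) hcard) le_rfl), _, π, hπ,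
    π x, π '' hull F U, (Set.ext_iff.1 hopens _).1 hopen, ⟨x, hxh, rfl⟩, ?_⟩
  rw [← hopens, codeSat_quotient_iff hF hs hmem hatom hπ d (by omega) x _ hopen ⟨x, hxh, rfl⟩,
    hpre, ← hs d (by omega) U _ hU (isOpen_hull hF U)
      (agreeOn_of_subset_hull (subset_hull U) subset_rfl) x hx hxh]
  exact h

end FiniteModel

/-! ### Finite models coded by natural numbers -/

section Certificate

/-- The bit mask `j` is closed under the relation on `{0, …, n - 1}` with bit table `r`. -/
def UpMask (n r j : ℕ) : Prop :=
  ∀ x < n, ∀ y < n, ¬ (j.testBit x ∧ r.testBit (x * n + y)) ∨ j.testBit y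

/-- Inclusion of bit masks on `{0, …, n - 1}`. -/
def SubMask (n k j : ℕ) : Prop :=
  ∀ x < n, ¬ k.testBit x ∨ j.testBit x

/-- The entry for formula `e`, point `x` and mask `j` of the truth table `s`. -/
def Entry (n s e x j : ℕ) : Prop :=
  s.testBit ((e * n + x) * 2 ^ n + j)

/-- The truth condition of `e` at `(x, j)`, in terms of the truth table `s` for subformulas and
the valuation with bit table `w`; the atoms `t` and `f` are true and false. -/
def Clause (t f n r w s e x j : ℕ) : Prop :=
  (e % 5 = 0 ∧ (e / 5 = t ∨ (¬ e / 5 = f ∧ w.testBit (e / 5 * n + x)))) ∨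
  (e % 5 = 1 ∧ ¬ Entry n s (e / 5) x j) ∨
  (e % 5 = 2 ∧ ∀ k < 2 ^ n, ¬ (UpMask n r k ∧ SubMask n k j ∧ k.testBit x) ∨
    Entry n s (e / 5) x k) ∨
  (e % 5 = 3 ∧ ∀ y < n, ¬ j.testBit y ∨ Entry n s (e / 5) y j) ∨
  (e % 5 = 4 ∧ Entry n s (e / 5).unpair.1 x j ∧ Entry n s (e / 5).unpair.2 x j)

/-- The tables `r`, `w` and `s` describe a finite model on `{0, …, n - 1}` with the truth values
of all formulas up to `d`, in which `d` is not valid. -/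
def Refutes (t f d n r w s : ℕ) : Prop :=
  (∀ e < d + 1, ∀ x < n, ∀ j < 2 ^ n, ¬ (UpMask n r j ∧ j.testBit x) ∨
    ((Entry n s e x j ∧ Clause t f n r w s e x j) ∨
      (¬ Entry n s e x j ∧ ¬ Clause t f n r w s e x j))) ∧
  ∃ x < n, ∃ j < 2 ^ n, (UpMask n r j ∧ j.testBit x) ∧ ¬ Entry n s d x j

/-- The formula with code `d` is refuted by a finite model of bounded size. -/
def Refutable (t f d : ℕ) : Prop :=
  ∃ n < sizeBound d + 1, ∃ r < 2 ^ (n * n), ∃ w < 2 ^ ((d + 1) * n),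
    ∃ s < 2 ^ ((d + 1) * n * 2 ^ n), Refutes t f d n r w s

theorem exists_bits (N : ℕ) (P : ℕ → Prop) :
    ∃ c < 2 ^ N, ∀ i < N, c.testBit i = true ↔ P i := by
  classical
  refine ⟨Nat.ofBits fun i : Fin N => decide (P i), Nat.ofBits_lt_two_pow _, fun i hi => ?_⟩
  rw [Nat.testBit_ofBits_lt _ _ hi]
  simp

theorem mul_add_inj {n a b x y : ℕ} (hx : x < n) (hy : y < n) (h : a * n + x = b * n + y) :
    a = b ∧ x = y := by
  have h1 := congrArg (· / n) h
  have h2 := congrArg (· % n) h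
  have hn : 0 < n := by omega
  simp only [Nat.mul_add_mod_self_right, Nat.mod_eq_of_lt hx,
    Nat.mod_eq_of_lt hy, Nat.add_div_of_dvd_right (Dvd.intro_left _ rfl), Nat.mul_div_cancel _ hn,
    Nat.div_eq_of_lt hx, Nat.div_eq_of_lt hy] at h1 h2
  exact ⟨h1, h2⟩

theorem mul_add_lt {n m a x : ℕ} (ha : a < m) (hx : x < n) : a * n + x < m * n := by
  calc a * n + x < (a + 1) * n := by rw [Nat.succ_mul]; omega
    _ ≤ m * n := Nat.mul_le_mul ha le_rfl

variable {X : Type*} {n : ℕ} (ε : X ≃ Fin n)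

/-- The set of points described by a bit mask. -/
def bitSet (j : ℕ) : Set X :=
  {x | j.testBit (ε x)}

variable {ε}

theorem forall_lt_iff {P : ℕ → Prop} : (∀ y < n, P y) ↔ ∀ y : X, P (ε y) := by
  constructor
  · exact fun h y => h _ (ε y).2
  · intro h y hy
    simpa using h (ε.symm ⟨y, hy⟩)

theorem exists_lt_iff {P : ℕ → Prop} : (∃ y < n, P y) ↔ ∃ y : X, P (ε y) := by
  have := (forall_lt_iff (ε := ε) (P := fun y => ¬ P y)).not
  push Not at this
  exact this

/-- Quantifying over masks below `2 ^ n` therefore amounts to quantifying over all subsets. -/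
theorem exists_bitSet_eq (U : Set X) : ∃ k < 2 ^ n, bitSet ε k = U := by
  obtain ⟨k, hk, h⟩ := exists_bits n fun i => ∃ x, (ε x : ℕ) = i ∧ x ∈ U
  refine ⟨k, hk, Set.ext fun x => (h _ (ε x).2).trans ⟨?_, fun hx => ⟨x, rfl, hx⟩⟩⟩
  rintro ⟨y, hy, hyU⟩
  rwa [← ε.injective (Fin.ext hy)]

theorem upMask_iff {R : X → X → Prop} {r : ℕ}
    (hr : ∀ x y, r.testBit (ε x * n + ε y) = true ↔ R x y) {j : ℕ} :
    UpMask n r j ↔ bitSet ε j ∈ upClosed R := by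
  simp only [UpMask, forall_lt_iff (ε := ε), hr]
  constructor
  · exact fun h x hx y hxy => (h x y).resolve_left fun hn => hn ⟨hx, hxy⟩
  · exact fun h x y => or_iff_not_imp_left.2 fun hn => h x (not_not.1 hn).1 y (not_not.1 hn).2

theorem subMask_iff {k j : ℕ} : SubMask n k j ↔ bitSet ε k ⊆ bitSet ε j := by
  simp only [SubMask, forall_lt_iff (ε := ε), ← imp_iff_not_or]
  rfl

/-- A clause consults the table only at smaller codes and at pairs with an open set containing the
point, so correctness is assumed only there. This serves both the soundness and the completeness of
certificates. -/
theorem clause_iff {R : X → X → Prop} {v : ℕ → Set X} {t f r w s e : ℕ}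
    (hr : ∀ x y, r.testBit (ε x * n + ε y) = true ↔ R x y)
    (hw : ∀ x, x ∈ v (e / 5) ↔ e / 5 = t ∨ (¬ e / 5 = f ∧ w.testBit (e / 5 * n + ε x) = true))
    (hs : ∀ e' < e, ∀ x, ∀ j < 2 ^ n, bitSet ε j ∈ upClosed R → x ∈ bitSet ε j →
      (Entry n s e' (ε x) j ↔ CodeSat (upClosed R) v e' x (bitSet ε j)))
    {x : X} {j : ℕ} (hj : j < 2 ^ n) (hup : bitSet ε j ∈ upClosed R) (hx : x ∈ bitSet ε j) :
    Clause t f n r w s e (ε x) j ↔ CodeSat (upClosed R) v e x (bitSet ε j) := by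
  have h1 := Nat.unpair_left_le (e / 5)
  have h2 := Nat.unpair_right_le (e / 5)
  have h : e % 5 = 0 ∨ e % 5 = 1 ∨ e % 5 = 2 ∨ e % 5 = 3 ∨ e % 5 = 4 := by omega
  rcases h with h | h | h | h | h
  · simp [Clause, h, codeSat_atom h, hw]
  · simp [Clause, h, codeSat_neg h, hs (e / 5) (by omega) x j hj hup hx]
  · rw [codeSat_box h]
    simp only [Clause, h, upMask_iff hr, subMask_iff (ε := ε)]
    norm_num
    constructor
    · intro hk V hV hVj hxV
      obtain ⟨k, hk2, rfl⟩ := exists_bitSet_eq (ε := ε) V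
      exact (hs (e / 5) (by omega) x k hk2 hV hxV).1
        ((hk k hk2).resolve_left fun hn => Bool.false_ne_true ((hn hV hVj).symm.trans hxV))
    · intro hV k hk2
      by_cases hc : bitSet ε k ∈ upClosed R ∧ bitSet ε k ⊆ bitSet ε j ∧ x ∈ bitSet ε k
      · exact Or.inr ((hs (e / 5) (by omega) x k hk2 hc.1 hc.2.2).2 (hV _ hc.1 hc.2.1 hc.2.2))
      · exact Or.inl fun a b => Bool.eq_false_iff.2 fun hh => hc ⟨a, b, hh⟩
  · rw [codeSat_know h]
    simp only [Clause, h, forall_lt_iff (ε := ε), ← imp_iff_not_or]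
    norm_num
    exact forall_congr' fun y => imp_congr_right fun hy => hs (e / 5) (by omega) y j hj hup hy
  · simp [Clause, h, codeSat_and h, hs (e / 5).unpair.1 (by omega) x j hj hup hx,
      hs (e / 5).unpair.2 (by omega) x j hj hup hx]

/-- By recursion on codes, the clauses force the table to agree with satisfaction at all legitimate
pairs; the other entries are arbitrary. -/
theorem entry_iff_of_refutes {t f d r w s : ℕ} {R : X → X → Prop} {v : ℕ → Set X}
    (hr : ∀ x y, r.testBit (ε x * n + ε y) = true ↔ R x y)
    (hw : ∀ a x, x ∈ v a ↔ a = t ∨ (¬ a = f ∧ w.testBit (a * n + ε x) = true))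
    (h : Refutes t f d n r w s) (e : ℕ) : e ≤ d → ∀ x, ∀ j < 2 ^ n, bitSet ε j ∈ upClosed R →
      x ∈ bitSet ε j → (Entry n s e (ε x) j ↔ CodeSat (upClosed R) v e x (bitSet ε j)) := by
  induction e using Nat.strong_induction_on with
  | _ e ih =>
    intro he x j hj hup hx
    rw [← clause_iff (t := t) (f := f) (w := w) hr (hw _)
      (fun e' he' => ih e' he' (by omega)) hj hup hx]
    exact iff_iff_and_or_not_and_not.2 ((h.1 e (by omega) (ε x) (ε x).2 j hj).resolve_left
      fun hn => hn ⟨(upMask_iff hr).2 hup, hx⟩)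

theorem exists_countermodel_of_refutes {t f d r w s : ℕ} (htf : t ≠ f)
    (h : Refutes t f d n r w s) (ε : X ≃ Fin n) :
    ∃ (_ : TopologicalSpace X) (v : ℕ → Set X), v t = Set.univ ∧ v f = ∅ ∧
      ∃ (x : X) (U : Set X), IsOpen U ∧ x ∈ U ∧ ¬ CodeSat {V | IsOpen V} v d x U := by
  let R : X → X → Prop := fun x y => r.testBit (ε x * n + ε y)
  let v : ℕ → Set X := fun a => {x | a = t ∨ (¬ a = f ∧ w.testBit (a * n + ε x) = true)}
  -- The sets closed under an arbitrary relation form a topology, so a certificate need not ensure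
  -- that `R` is reflexive or transitive.
  let τ : TopologicalSpace X :=
    { IsOpen := fun U => U ∈ upClosed R
      isOpen_univ := fun _ _ _ _ => trivial
      isOpen_inter := fun U V hU hV x hx y hxy => ⟨hU x hx.1 y hxy, hV x hx.2 y hxy⟩
      isOpen_sUnion := fun S hS x ⟨U, hU, hx⟩ y hxy => ⟨U, hU, hS U hU x hx y hxy⟩ }
  obtain ⟨x, j, hj, ⟨hup, hx⟩, hn⟩ := (exists_lt_iff (ε := ε)).1 h.2
  refine ⟨τ, v, ?_, ?_, x, bitSet ε j, (upMask_iff fun _ _ => Iff.rfl).1 hup, hx, ?_⟩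
  · ext; simp [v]
  · ext; simp [v, htf.symm]
  · exact fun hc => hn ((entry_iff_of_refutes (R := R) (v := v) (fun _ _ => Iff.rfl)
      (fun _ _ => Iff.rfl) h d le_rfl x j hj ((upMask_iff fun _ _ => Iff.rfl).1 hup) hx).2 hc)

theorem exists_refutes {t f d : ℕ} {R : X → X → Prop} {v : ℕ → Set X} (ε : X ≃ Fin n)
    (ht : v t = Set.univ) (hf : v f = ∅) {x : X} {U : Set X} (hU : U ∈ upClosed R) (hx : x ∈ U)
    (h : ¬ CodeSat (upClosed R) v d x U) :
    ∃ r < 2 ^ (n * n), ∃ w < 2 ^ ((d + 1) * n), ∃ s < 2 ^ ((d + 1) * n * 2 ^ n),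
      Refutes t f d n r w s := by
  obtain ⟨r, hr, hrb⟩ := exists_bits (n * n) fun i => ∃ x y, i = ε x * n + ε y ∧ R x y
  obtain ⟨w, hw, hwb⟩ := exists_bits ((d + 1) * n) fun i => ∃ a x, i = a * n + ε x ∧ x ∈ v a
  obtain ⟨s, hs, hsb⟩ := exists_bits ((d + 1) * n * 2 ^ n) fun i => ∃ e x, ∃ j < 2 ^ n,
    i = (e * n + ε x) * 2 ^ n + j ∧ CodeSat (upClosed R) v e x (bitSet ε j)
  have hr' : ∀ x y, r.testBit (ε x * n + ε y) = true ↔ R x y := by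
    intro x y
    rw [hrb _ (mul_add_lt (ε x).2 (ε y).2)]
    refine ⟨?_, fun h => ⟨x, y, rfl, h⟩⟩
    rintro ⟨x', y', he, hR⟩
    obtain ⟨h1, h2⟩ := mul_add_inj (ε y).2 (ε y').2 he
    rwa [ε.injective (Fin.ext h1), ε.injective (Fin.ext h2)]
  -- Tabulating atoms up to `d` suffices, since a clause for `e ≤ d` reads only the atom `e / 5`.
  have hw' : ∀ a < d + 1, ∀ x, x ∈ v a ↔ a = t ∨ (¬ a = f ∧ w.testBit (a * n + ε x) = true) := by
    intro a ha x
    rw [hwb _ (mul_add_lt ha (ε x).2)]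
    constructor
    · exact fun hx => Or.inr ⟨by rintro rfl; simp [hf] at hx, a, x, rfl, hx⟩
    · rintro (rfl | ⟨-, a', x', he, hx⟩)
      · simp [ht]
      · obtain ⟨h1, h2⟩ := mul_add_inj (ε x).2 (ε x').2 he
        rwa [h1, ε.injective (Fin.ext h2)]
  have hs' : ∀ e < d + 1, ∀ x, ∀ j < 2 ^ n,
      (Entry n s e (ε x) j ↔ CodeSat (upClosed R) v e x (bitSet ε j)) := by
    intro e he x j hj
    rw [Entry, hsb _ (mul_add_lt (mul_add_lt he (ε x).2) hj)]
    refine ⟨?_, fun h => ⟨e, x, j, hj, rfl, h⟩⟩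
    rintro ⟨e', x', j', hj', heq, hc⟩
    obtain ⟨h1, rfl⟩ := mul_add_inj hj hj' heq
    obtain ⟨rfl, h2⟩ := mul_add_inj (ε x).2 (ε x').2 h1
    rwa [ε.injective (Fin.ext h2)]
  refine ⟨r, hr, w, hw, s, hs, fun e he => (forall_lt_iff (ε := ε)).2 fun y j hj => ?_,
    (exists_lt_iff (ε := ε)).2 ?_⟩
  · rw [or_iff_not_imp_left, not_not]
    rintro ⟨hup, hy⟩
    have hup' := (upMask_iff hr').1 hup
    have := clause_iff (t := t) (f := f) (w := w) (s := s) hr' (hw' (e / 5) (by omega))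
      (fun e' he' x j hj _ _ => hs' e' (by omega) x j hj) hj hup' hy
    rw [this, hs' e he y j hj]
    exact iff_iff_and_or_not_and_not.1 Iff.rfl
  · obtain ⟨j, hj, rfl⟩ := exists_bitSet_eq (ε := ε) U
    exact ⟨x, j, hj, ⟨(upMask_iff hr').2 hU, hx⟩, fun hc => h ((hs' d (by omega) x j hj).1 hc)⟩

end Certificate

/-! ### Validity as absence of a bounded certificate -/

theorem mem_topologicalTheory_iff_not_refutable {A : Type v} [Encodable A] {t f : A} (htf : t ≠ f)
    (φ : BimodalFormula A) :
    φ ∈ topologicalTheory.{u, v} t f ↔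
      ¬ Refutable (Encodable.encode t) (Encodable.encode f) φ.toCode := by
  rw [mem_topologicalTheory_iff]
  constructor
  · rintro h ⟨n, -, r, -, w, -, s, -, href⟩
    -- The finite model is lifted to the universe over which the theory quantifies; the size bound
    -- plays no role in this direction.
    obtain ⟨τ, v, ht, hf, x, U, hU, hx, hn⟩ := exists_countermodel_of_refutes
      (fun he => htf (Encodable.encode_injective he)) href (Equiv.ulift.{u} : ULift (Fin n) ≃ Fin n)
    exact hn (h _ v ht hf x U hU hx)
  · intro h X _ v ht hf x U hU hx
    by_contra hn
    obtain ⟨n, hle, R, π, hπ, y, O, hO, hy, hc⟩ := exists_finite_countermodel hU hx hn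
    refine h ⟨n, Nat.lt_succ_of_le hle, exists_refutes (Equiv.refl _) ?_ ?_ hO hy hc⟩
    -- Surjectivity of `π` keeps the image of the true atom equal to the whole space, even if its
    -- code exceeds those respected by the quotient.
    · rw [ht, Set.image_univ, hπ.range_eq]
    · rw [hf, Set.image_empty]

/-! ### Primitive recursiveness of the certificate search -/

section Computability

open Primrec

variable {α : Type*} [Primcodable α]

theorem PrimrecPred.forall_lt_of {b : α → ℕ} {P : α → ℕ → Prop} (hb : Primrec b)
    (hP : PrimrecPred fun p : α × ℕ => P p.1 p.2) : PrimrecPred fun a => ∀ x < b a, P a x := by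
  have h : PrimrecRel fun (x : ℕ) (a : α) => P a x := hP.comp (Primrec.pair snd fst)
  exact (h.forall_mem_list.comp (list_range.comp hb) Primrec.id).of_eq fun a => by simp

theorem PrimrecPred.exists_lt_of {b : α → ℕ} {P : α → ℕ → Prop} (hb : Primrec b)
    (hP : PrimrecPred fun p : α × ℕ => P p.1 p.2) : PrimrecPred fun a => ∃ x < b a, P a x := by
  have h : PrimrecRel fun (x : ℕ) (a : α) => P a x := hP.comp (Primrec.pair snd fst)
  exact (h.exists_mem_list.comp (list_range.comp hb) Primrec.id).of_eq fun a => by simp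

theorem primrec_pow : Primrec₂ fun a b : ℕ => a ^ b :=
  Primrec₂.unpaired'.1 Nat.Primrec.pow

theorem primrec_two_pow {f : α → ℕ} (hf : Primrec f) : Primrec fun a => 2 ^ f a :=
  primrec_pow.comp (Primrec.const 2) hf

theorem primrec_splitBound : Primrec splitBound := by
  have hb : Primrec fun p : ℕ × ℕ => p.2 := snd
  exact Primrec.nat_rec₁ 0 (nat_add.comp hb
    (nat_add.comp (primrec_two_pow hb) (nat_mul.comp (primrec_two_pow hb) hb)))

theorem primrec_sizeBound : Primrec sizeBound :=
  nat_mul.comp (primrec_two_pow (primrec_splitBound.comp succ)) (primrec_two_pow succ)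

section

variable {t f d n r w s e x j k : α → ℕ}

theorem primrecPred_testBit (hj : Primrec j) (hx : Primrec x) :
    PrimrecPred fun a => (j a).testBit (x a) = true :=
  (Primrec.eq.comp (nat_mod.comp (nat_div.comp hj (primrec_two_pow hx)) (const 2))
    (const 1)).of_eq fun a => by rw [Nat.testBit_eq_decide_div_mod_eq, decide_eq_true_iff]

theorem primrecPred_upMask (hn : Primrec n) (hr : Primrec r) (hj : Primrec j) :
    PrimrecPred fun a => UpMask (n a) (r a) (j a) := by
  refine .forall_lt_of hn (.forall_lt_of (hn.comp fst) (.or (.not (.and ?_ ?_)) ?_))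
  · exact primrecPred_testBit (hj.comp (fst.comp fst)) (snd.comp fst)
  · exact primrecPred_testBit (hr.comp (fst.comp fst))
      (nat_add.comp (nat_mul.comp (snd.comp fst) (hn.comp (fst.comp fst))) snd)
  · exact primrecPred_testBit (hj.comp (fst.comp fst)) snd

theorem primrecPred_subMask (hn : Primrec n) (hk : Primrec k) (hj : Primrec j) :
    PrimrecPred fun a => SubMask (n a) (k a) (j a) :=
  .forall_lt_of hn (.or (.not (primrecPred_testBit (hk.comp fst) snd))
    (primrecPred_testBit (hj.comp fst) snd))

theorem primrecPred_entry (hn : Primrec n) (hs : Primrec s) (he : Primrec e) (hx : Primrec x)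
    (hj : Primrec j) : PrimrecPred fun a => Entry (n a) (s a) (e a) (x a) (j a) :=
  primrecPred_testBit hs (nat_add.comp (nat_mul.comp (nat_add.comp (nat_mul.comp he hn) hx)
    (primrec_two_pow hn)) hj)

theorem primrecPred_clause (ht : Primrec t) (hf : Primrec f) (hn : Primrec n) (hr : Primrec r)
    (hw : Primrec w) (hs : Primrec s) (he : Primrec e) (hx : Primrec x) (hj : Primrec j) :
    PrimrecPred fun a =>
      Clause (t a) (f a) (n a) (r a) (w a) (s a) (e a) (x a) (j a) := by
  have hm : ∀ c, PrimrecPred fun a => e a % 5 = c := fun c =>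
    Primrec.eq.comp (nat_mod.comp he (const 5)) (const c)
  have hd : Primrec fun a => e a / 5 := nat_div.comp he (const 5)
  have hu : Primrec fun a => (e a / 5).unpair := unpair.comp hd
  refine .or (.and (hm 0) (.or (Primrec.eq.comp hd ht) (.and (.not (Primrec.eq.comp hd hf)) ?_)))
    (.or (.and (hm 1) (.not (primrecPred_entry hn hs hd hx hj)))
    (.or (.and (hm 2) (.forall_lt_of (primrec_two_pow hn) (.or (.not (.and ?_ (.and ?_ ?_))) ?_)))
    (.or (.and (hm 3) (.forall_lt_of hn (.or (.not ?_) ?_)))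
    (.and (hm 4) (.and (primrecPred_entry hn hs (fst.comp hu) hx hj)
      (primrecPred_entry hn hs (snd.comp hu) hx hj))))))
  · exact primrecPred_testBit hw (nat_add.comp (nat_mul.comp hd hn) hx)
  · exact primrecPred_upMask (hn.comp fst) (hr.comp fst) snd
  · exact primrecPred_subMask (hn.comp fst) snd (hj.comp fst)
  · exact primrecPred_testBit snd (hx.comp fst)
  · exact primrecPred_entry (hn.comp fst) (hs.comp fst) (hd.comp fst) (hx.comp fst) snd
  · exact primrecPred_testBit (hj.comp fst) snd
  · exact primrecPred_entry (hn.comp fst) (hs.comp fst) (hd.comp fst) snd (hj.comp fst)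

theorem primrecPred_refutes (ht : Primrec t) (hf : Primrec f) (hd : Primrec d) (hn : Primrec n)
    (hr : Primrec r) (hw : Primrec w) (hs : Primrec s) :
    PrimrecPred fun a => Refutes (t a) (f a) (d a) (n a) (r a) (w a) (s a) := by
  refine .and (.forall_lt_of (succ.comp hd) (.forall_lt_of (hn.comp fst)
    (.forall_lt_of (primrec_two_pow (hn.comp (fst.comp fst))) ?_)))
    (.exists_lt_of hn (.exists_lt_of (primrec_two_pow (hn.comp fst)) ?_))
  · have lift : ∀ {g : α → ℕ}, Primrec g → Primrec fun p : ((α × ℕ) × ℕ) × ℕ => g p.1.1.1 :=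
      fun hg => hg.comp (fst.comp (fst.comp fst))
    have he : Primrec fun p : ((α × ℕ) × ℕ) × ℕ => p.1.1.2 := snd.comp (fst.comp fst)
    have hx : Primrec fun p : ((α × ℕ) × ℕ) × ℕ => p.1.2 := snd.comp fst
    have hE := primrecPred_entry (lift hn) (lift hs) he hx snd
    have hC := primrecPred_clause (lift ht) (lift hf) (lift hn) (lift hr) (lift hw) (lift hs)
      he hx snd
    exact .or (.not (.and (primrecPred_upMask (lift hn) (lift hr) snd)
      (primrecPred_testBit snd hx))) (.or (.and hE hC) (.and (.not hE) (.not hC)))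
  · have lift : ∀ {g : α → ℕ}, Primrec g → Primrec fun p : (α × ℕ) × ℕ => g p.1.1 :=
      fun hg => hg.comp (fst.comp fst)
    have hx : Primrec fun p : (α × ℕ) × ℕ => p.1.2 := snd.comp fst
    exact .and (.and (primrecPred_upMask (lift hn) (lift hr) snd) (primrecPred_testBit snd hx))
      (.not (primrecPred_entry (lift hn) (lift hs) (lift hd) hx snd))

end

theorem primrecPred_refutable (t f : ℕ) : PrimrecPred fun d => Refutable t f d := by
  refine .exists_lt_of (succ.comp primrec_sizeBound) (.exists_lt_of
    (primrec_two_pow (nat_mul.comp snd snd)) (.exists_lt_of (primrec_two_pow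
      (nat_mul.comp (succ.comp (fst.comp fst)) (snd.comp fst))) (.exists_lt_of (primrec_two_pow
        (nat_mul.comp (nat_mul.comp (succ.comp (fst.comp (fst.comp fst))) (snd.comp (fst.comp fst)))
          (primrec_two_pow (snd.comp (fst.comp fst))))) ?_)))
  exact primrecPred_refutes (const t) (const f) (fst.comp (fst.comp (fst.comp fst)))
    (snd.comp (fst.comp (fst.comp fst))) (snd.comp (fst.comp fst)) (snd.comp fst) snd

end Computability

theorem mainTheorem4 {A : Type v} [Primcodable A] (t f : A) (htf : t ≠ f) :
    ComputablePred fun φ : BimodalFormula A => φ ∈ topologicalTheory.{u, v} t f := by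
  refine (((primrecPred_refutable (Encodable.encode t) (Encodable.encode f)).comp
    Primrec.encode).not.of_eq fun φ => ?_).computablePred
  exact (mem_topologicalTheory_iff_not_refutable htf φ).symm
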